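/- Let $d\ge 2$. For a lattice $L\subset\mathbb{R}^d$ write $\lVert L\rVert=\min\{\lVert l\rVert : l\in L\setminus\{0\}\}$ (Euclidean norm), and call $L$ admissible if there is $C>0$ with $|l_1\cdots l_d|\ge C$ for all $l=(l_1,\dots,l_d)\in L\setminus\{0\}$. Let $$\Delta=\{\operatorname{Diag}(e^{t_1},\dots,e^{t_d}) : t\in\mathbb{Z}^d,\ t_1+\cdots+t_d=0\},$$ and for real $r$ let $\Delta_r\subset\Delta$ be the finite subset given by the $t$ with $\lVert t\rVert\le r$ (Euclidean norm). Let $L$ be an admissible lattice in $\mathbb{R}^d$ that is unimodular (of covolume $1$), and let $(\theta_\delta)_{\delta\in\Delta}$ be independent identically distributed symmetric real random variables on a probability space $\Omega$ with $\mathbb{E}|\theta_\delta|^3<\infty$. Let $v=\mathbb{E}(\theta_\delta^2)$ be their common variance. Set $$\tilde V(L,r)=\sum_{\delta\in\Delta_r}\frac{1}{\lVert\delta L\rVert^{2d}},\qquad \tilde S(L,\omega,r)=\sum_{\delta\in\Delta_r}\frac{\theta_\delta(\omega)}{\lVert\delta L\rVert^{d}}.$$ Then $\tilde V(L,r)=\Theta(r^{d-1})$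 as $r\to\infty$, that is, there is $C>0$ such that $C^{-1}r^{d-1}\le\tilde V(L,r)\le C\,r^{d-1}$ for all large enough $r$. Moreover, as $r\to\infty$ through the reals, $\tilde S(L,\cdot,r)/\sqrt{\tilde V(L,r)}$ converges in distribution to the centred normal law $\mathcal{N}(0,v)$ of variance $v$; in particular, to the standard normal law if $v=1$. -/

import Mathlib

open Filter MeasureTheory ProbabilityTheory Asymptotics
open scoped NNReal

/-- The product `l₁ ⋯ l_d` of the coordinates of `l`. -/
def coordProd {d : ℕ} (l : EuclideanSpace ℝ (Fin d)) : ℝ := ∏ i, l i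

/-- `L` is admissible: `|l₁ ⋯ l_d|` is bounded below by a positive constant on `L \ {0}`. -/
def IsAdmissible {d : ℕ} (L : Submodule ℤ (EuclideanSpace ℝ (Fin d))) : Prop :=
  ∃ C : ℝ, 0 < C ∧ ∀ l ∈ L, l ≠ 0 → C ≤ |coordProd l|

/-- The length of a shortest nonzero vector of `L` (for a lattice in positive dimension the
infimum is attained). -/
noncomputable def shortestLength {d : ℕ} (L : Submodule ℤ (EuclideanSpace ℝ (Fin d))) : ℝ :=
  sInf {x : ℝ | ∃ l ∈ L, l ≠ 0 ∧ x = ‖l‖}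

/-- The image `A L` of `L` under the linear map with matrix `A`. -/
noncomputable def matrixImage {d : ℕ} (A : Matrix (Fin d) (Fin d) ℝ)
    (L : Submodule ℤ (EuclideanSpace ℝ (Fin d))) : Submodule ℤ (EuclideanSpace ℝ (Fin d)) :=
  L.map ((Matrix.toEuclideanLin A).restrictScalars ℤ)

/-- The matrix `Diag(exp t₁, …, exp t_d)`. -/
noncomputable def expDiag {d : ℕ} (t : Fin d → ℤ) : Matrix (Fin d) (Fin d) ℝ :=
  Matrix.diagonal fun i => Real.exp (t i)

/-- The Euclidean norm of an integer vector. -/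
noncomputable def intVecNorm {d : ℕ} (t : Fin d → ℤ) : ℝ :=
  ‖WithLp.toLp 2 (fun i => (t i : ℝ))‖

/-- The set `Δ` of the matrices `Diag(exp t₁, …, exp t_d)`, `t ∈ ℤ^d`, `t₁ + ⋯ + t_d = 0`. -/
def Delta (d : ℕ) : Set (Matrix (Fin d) (Fin d) ℝ) :=
  {δ | ∃ t : Fin d → ℤ, ∑ i, t i = 0 ∧ δ = expDiag t}

/-- The set `Δ_r` of those elements of `Δ` whose exponent vector `t` satisfies `‖t‖ ≤ r`. -/
def DeltaBall (d : ℕ) (r : ℝ) : Set (Delta d) :=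
  {δ | ∃ t : Fin d → ℤ, ∑ i, t i = 0 ∧ intVecNorm t ≤ r ∧ (δ : Matrix (Fin d) (Fin d) ℝ) = expDiag t}

theorem DeltaBall_finite (d : ℕ) (r : ℝ) : (DeltaBall d r).Finite := by
  refine Set.Finite.of_finite_image (f := Subtype.val) ?_ Subtype.val_injective.injOn
  refine ((Set.finite_Icc (fun _ : Fin d => -⌈r⌉) (fun _ => ⌈r⌉)).image expDiag).subset ?_
  rintro _ ⟨δ, ⟨t, -, ht, hδ⟩, rfl⟩
  have key : ∀ i, |(t i : ℝ)| ≤ ⌈r⌉ := fun i => by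
    have h1 := PiLp.norm_apply_le (WithLp.toLp 2 (fun i => (t i : ℝ))) i
    exact (h1.trans ht).trans (Int.le_ceil r)
  refine ⟨t, ⟨fun i => ?_, fun i => ?_⟩, hδ.symm⟩
  · exact_mod_cast (abs_le.1 (key i)).1
  · exact_mod_cast (abs_le.1 (key i)).2

/-- `Δ_r` as a finite set. -/
noncomputable def deltaFinset (d : ℕ) (r : ℝ) : Finset (Delta d) :=
  (DeltaBall_finite d r).toFinset

/-- `Ṽ(L, r) = ∑_{δ ∈ Δ_r} ‖δ L‖^{-2d}`. -/
noncomputable def tildeV {d : ℕ} (L : Submodule ℤ (EuclideanSpace ℝ (Fin d))) (r : ℝ) : ℝ :=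
  ∑ δ ∈ deltaFinset d r, 1 / shortestLength (matrixImage δ.1 L) ^ (2 * d)

/-- `S̃(L, ω, r) = ∑_{δ ∈ Δ_r} θ_δ(ω) ‖δ L‖^{-d}`. -/
noncomputable def tildeS {d : ℕ} {Ω : Type*} (θ : Delta d → Ω → ℝ)
    (L : Submodule ℤ (EuclideanSpace ℝ (Fin d))) (ω : Ω) (r : ℝ) : ℝ :=
  ∑ δ ∈ deltaFinset d r, θ δ ω / shortestLength (matrixImage δ.1 L) ^ d

open scoped Topology

/-! ### Central limit theorem for bounded weights. -/

section WeightedCLT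

/-! Elements of `Δ` have determinant 1 and preserve `coordProd`. Admissibility therefore bounds
`‖δL‖` below uniformly in `δ`, and Minkowski's theorem bounds it above
(`exists_shortestLength_bounds`). The weights `‖δL‖^{-d}` thus lie between two positive constants,
so `tildeV L r` is comparable to the number of points of norm at most `r` in a lattice of rank `d -
1` (`card_deltaFinset_isTheta`).

Since `tildeV` tends to infinity and the weights are bounded, no single term of the normalised sum
matters in the limit, and a characteristic function argument gives normality
(`tendstoInDistribution_weighted_sum`). -/

theorem norm_prod_sub_prod_le_sum {ι : Type*} (s : Finset ι) (f g : ι → ℂ)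
    (hf : ∀ i ∈ s, ‖f i‖ ≤ 1) (hg : ∀ i ∈ s, ‖g i‖ ≤ 1) :
    ‖∏ i ∈ s, f i - ∏ i ∈ s, g i‖ ≤ ∑ i ∈ s, ‖f i - g i‖ := by
  classical
  induction s using Finset.induction_on with
  | empty => simp
  | insert a s ha ih =>
    rw [Finset.prod_insert ha, Finset.prod_insert ha, Finset.sum_insert ha]
    have ih' := ih (fun i hi => hf i (Finset.mem_insert_of_mem hi))
      (fun i hi => hg i (Finset.mem_insert_of_mem hi))
    have hprod : ‖∏ i ∈ s, f i‖ ≤ 1 := by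
      rw [norm_prod]
      exact Finset.prod_le_one (fun _ _ => norm_nonneg _)
        fun i hi => hf i (Finset.mem_insert_of_mem hi)
    have hga := hg a (Finset.mem_insert_self a s)
    calc ‖f a * ∏ i ∈ s, f i - g a * ∏ i ∈ s, g i‖
        = ‖(f a - g a) * ∏ i ∈ s, f i + g a * (∏ i ∈ s, f i - ∏ i ∈ s, g i)‖ := by
          congr 1; ring
      _ ≤ ‖f a - g a‖ * ‖∏ i ∈ s, f i‖ + ‖g a‖ * ‖∏ i ∈ s, f i - ∏ i ∈ s, g i‖ := by
          refine (norm_add_le _ _).trans ?_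
          rw [norm_mul, norm_mul]
      _ ≤ ‖f a - g a‖ * 1 + 1 * ∑ i ∈ s, ‖f i - g i‖ := by gcongr
      _ = _ := by ring

variable {Ω : Type*} [MeasurableSpace Ω] {P : Measure Ω} [IsProbabilityMeasure P]

theorem charFun_map_sub_isLittleO_sq {X : Ω → ℝ} (hX : MemLp X 2 P)
    (hmean : ∫ ω, X ω ∂P = 0) {v : ℝ} (hv : ∫ ω, X ω ^ 2 ∂P = v) :
    (fun t : ℝ => charFun (P.map X) t - (1 - (v : ℂ) * t ^ 2 / 2)) =o[𝓝 0] fun t => t ^ 2 := by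
  have hm : AEMeasurable X P := hX.aestronglyMeasurable.aemeasurable
  have hint : MemLp id 2 (P.map X) := by
    rw [memLp_map_measure_iff aestronglyMeasurable_id hm]
    exact hX
  have : IsProbabilityMeasure (P.map X) := Measure.isProbabilityMeasure_map hm
  have key : ∀ t : ℝ, (1 - (v : ℂ) * t ^ 2 / 2)
      = taylorWithinEval (charFun (P.map X)) 2 Set.univ 0 t := by
    intro t
    have hv' : ∫ ω, (X ^ 2) ω ∂P = v := hv
    rw [taylorWithinEval_charFun_two_zero hm hint, hmean, hv']
    simp
  simp_rw [key]
  convert! taylor_isLittleO_univ (contDiff_charFun hint) using 2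
  simp

theorem charFun_map_sub_charFun_gaussianReal_isLittleO {X : Ω → ℝ} (hX : MemLp X 2 P)
    (hmean : ∫ ω, X ω ∂P = 0) {v : ℝ≥0} (hv : ∫ ω, X ω ^ 2 ∂P = v) :
    (fun t => charFun (P.map X) t - charFun (gaussianReal 0 v) t) =o[𝓝 0] fun t => t ^ 2 := by
  have h2 := charFun_map_sub_isLittleO_sq (memLp_id_gaussianReal (μ := 0) (v := v) 2) (by simp)
    (v := v) (by
      have := variance_id_gaussianReal (μ := 0) (v := v)
      rw [variance_eq_integral (by fun_prop)] at this
      simpa using this)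
  rw [Measure.map_id] at h2
  convert! (charFun_map_sub_isLittleO_sq hX hmean hv).sub h2 using 2
  ring

/-- Lindeberg's replacement: by independence the left side is a product of values of `φ` at points
`x k i` with squares summing to `ξ ^ 2`, and the Gaussian `g ξ` factors over the same points.
Bounded weights make these points uniformly small, where `φ - g` is `o(t ^ 2)`. -/
theorem tendsto_charFun_weighted_sum {ι κ : Type*} {l : Filter κ}
    {θ : ι → Ω → ℝ} {X : Ω → ℝ} (hX : MemLp X 2 P)
    (hmean : ∫ ω, X ω ∂P = 0) {v : ℝ≥0} (hv : ∫ ω, X ω ^ 2 ∂P = v)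
    (hindep : iIndepFun θ P) (hident : ∀ i, IdentDistrib (θ i) X P P)
    {w : ι → ℝ} {c : ℝ} (hw : ∀ i, |w i| ≤ c) {F : κ → Finset ι}
    (hF : Tendsto (fun k => ∑ i ∈ F k, w i ^ 2) l atTop) (ξ : ℝ) :
    Tendsto (fun k => charFun
      (P.map fun ω => (∑ i ∈ F k, θ i ω * w i) / √(∑ i ∈ F k, w i ^ 2)) ξ) l
      (𝓝 (charFun (gaussianReal 0 v) ξ)) := by
  set φ := charFun (P.map X)
  set g := charFun (gaussianReal 0 v)
  set V : κ → ℝ := fun k => ∑ i ∈ F k, w i ^ 2 with hVdef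
  have hm i : AEMeasurable (θ i) P := (hident i).aemeasurable_fst
  have : IsProbabilityMeasure (P.map X) :=
    Measure.isProbabilityMeasure_map hX.aestronglyMeasurable.aemeasurable
  set x : κ → ι → ℝ := fun k i => w i / √(V k) * ξ with hx
  have hprod k : charFun (P.map fun ω => (∑ i ∈ F k, θ i ω * w i) / √(V k)) ξ
      = ∏ i ∈ F k, φ (x k i) := by
    have e1 : (fun ω => (∑ i ∈ F k, θ i ω * w i) / √(V k))
        = fun ω => ∑ i ∈ F k, (w i / √(V k)) * θ i ω := by
      funext ω
      rw [Finset.sum_div]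
      exact Finset.sum_congr rfl fun i _ => by ring
    have hind : iIndepFun (fun i ω => (w i / √(V k)) * θ i ω) P :=
      hindep.comp (fun i y => (w i / √(V k)) * y) fun i => by fun_prop
    rw [e1, (hind.restrict (F k)).charFun_map_fun_finsetSum_eq_prod
      (fun i _ => (hm i).const_mul _), Finset.prod_apply]
    refine Finset.prod_congr rfl fun i _ => ?_
    rw [charFun_map_mul_comp (hm i), (hident i).map_eq]
  have hsum k (hk : 0 < V k) : ∑ i ∈ F k, x k i ^ 2 = ξ ^ 2 := by
    simp only [hx, mul_pow, div_pow, Real.sq_sqrt hk.le]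
    rw [← Finset.sum_mul, ← Finset.sum_div, div_self hk.ne', one_mul]
  have hgprod k (hk : 0 < V k) : g ξ = ∏ i ∈ F k, g (x k i) := by
    simp only [g, charFun_gaussianReal]
    rw [← Complex.exp_sum]
    congr 1
    have := congrArg (fun y : ℝ => (y : ℂ)) (hsum k hk)
    push_cast at this
    simp only [Complex.ofReal_zero, mul_zero, zero_mul, zero_sub]
    rw [← this, Finset.mul_sum, Finset.sum_div, Finset.sum_neg_distrib]
  have hsmall : Tendsto (fun k => c / √(V k) * |ξ|) l (𝓝 0) := by
    have := (tendsto_const_nhds (x := c)).div_atTop (Real.tendsto_sqrt_atTop.comp hF)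
    simpa using this.mul_const |ξ|
  rw [tendsto_iff_norm_sub_tendsto_zero]
  rw [Metric.tendsto_nhds]
  intro ε hε
  -- The errors will add up to this constant times `ξ ^ 2`, which is below `ε` even for `ξ = 0`.
  have hlo := (charFun_map_sub_charFun_gaussianReal_isLittleO hX hmean hv).def
    (c := ε / (2 * (ξ ^ 2 + 1))) (by positivity)
  obtain ⟨η, hη, hball⟩ := Metric.eventually_nhds_iff.1 hlo
  filter_upwards [hF.eventually_gt_atTop 0, hsmall.eventually_lt_const hη] with k hk hkη
  have hxi : ∀ i, ‖φ (x k i) - g (x k i)‖ ≤ ε / (2 * (ξ ^ 2 + 1)) * x k i ^ 2 := by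
    intro i
    have hi : dist (x k i) 0 < η := by
      refine lt_of_le_of_lt ?_ hkη
      rw [dist_zero_right, Real.norm_eq_abs, hx, abs_mul, abs_div, abs_of_nonneg (Real.sqrt_nonneg _)]
      gcongr
      exact hw i
    simpa using hball hi
  rw [hprod, hgprod k hk, dist_zero_right, norm_norm]
  calc _ ≤ ∑ i ∈ F k, ‖φ (x k i) - g (x k i)‖ :=
        norm_prod_sub_prod_le_sum _ _ _ (fun _ _ => norm_charFun_le_one _)
          fun _ _ => norm_charFun_le_one _
    _ ≤ ∑ i ∈ F k, ε / (2 * (ξ ^ 2 + 1)) * x k i ^ 2 := Finset.sum_le_sum fun i _ => hxi i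
    _ = ε / (2 * (ξ ^ 2 + 1)) * ξ ^ 2 := by rw [← Finset.mul_sum, hsum k hk]
    _ < ε := by
        rw [div_mul_eq_mul_div, div_lt_iff₀ (by positivity)]
        nlinarith [sq_nonneg ξ]

/-- A **central limit theorem for bounded weights**: if `θ` is an i.i.d. family of centred random
variables of variance `v`, the weights `w` are bounded and the sums of squares of the weights over
`F k` tend to infinity, then the normalised weighted sums over `F k` converge to `N(0, v)`. -/
theorem tendstoInDistribution_weighted_sum {ι κ : Type*} {l : Filter κ} [l.IsCountablyGenerated]
    {θ : ι → Ω → ℝ} {X : Ω → ℝ} (hX : MemLp X 2 P)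
    (hmean : ∫ ω, X ω ∂P = 0) {v : ℝ≥0} (hv : ∫ ω, X ω ^ 2 ∂P = v)
    (hindep : iIndepFun θ P) (hident : ∀ i, IdentDistrib (θ i) X P P)
    {w : ι → ℝ} {c : ℝ} (hw : ∀ i, |w i| ≤ c) {F : κ → Finset ι}
    (hF : Tendsto (fun k => ∑ i ∈ F k, w i ^ 2) l atTop) :
    TendstoInDistribution
      (fun k ω => (∑ i ∈ F k, θ i ω * w i) / √(∑ i ∈ F k, w i ^ 2)) l
      (id : ℝ → ℝ) (fun _ => P) (gaussianReal 0 v) where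
  forall_aemeasurable k := by
    have hm i : AEMeasurable (θ i) P := (hident i).aemeasurable_fst
    exact (Finset.aemeasurable_fun_sum _ fun i _ => (hm i).mul_const _).div_const _
  tendsto := by
    -- Lévy's continuity theorem is applied along sequences, which suffice for a countably generated
    -- filter.
    refine tendsto_of_seq_tendsto fun u hu => ?_
    refine ProbabilityMeasure.tendsto_of_tendsto_charFun fun ξ => ?_
    simp only [Measure.map_id]
    exact tendsto_charFun_weighted_sum hX hmean hv hindep hident hw (hF.comp hu) ξ

end WeightedCLT

/-! ### Uniform bounds for the shortest vector of `δL`. -/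

section ShortestLength

variable {d : ℕ}

theorem toEuclideanLin_expDiag_apply (t : Fin d → ℤ) (x : EuclideanSpace ℝ (Fin d)) (i : Fin d) :
    Matrix.toEuclideanLin (expDiag t) x i = Real.exp (t i) * x i := by
  simp [expDiag, Matrix.toLpLin_apply, Matrix.mulVec_diagonal]

theorem prod_exp_eq_one {t : Fin d → ℤ} (ht : ∑ i, t i = 0) :
    ∏ i, Real.exp (t i) = 1 := by
  rw [← Real.exp_sum, ← Int.cast_sum, ht, Int.cast_zero, Real.exp_zero]

theorem coordProd_toEuclideanLin_expDiag {t : Fin d → ℤ} (ht : ∑ i, t i = 0)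
    (x : EuclideanSpace ℝ (Fin d)) :
    coordProd (Matrix.toEuclideanLin (expDiag t) x) = coordProd x := by
  simp only [coordProd, toEuclideanLin_expDiag_apply, Finset.prod_mul_distrib,
    prod_exp_eq_one ht, one_mul]

theorem det_toEuclideanLin_expDiag {t : Fin d → ℤ} (ht : ∑ i, t i = 0) :
    LinearMap.det (Matrix.toEuclideanLin (expDiag t)) = 1 := by
  rw [Matrix.toEuclideanLin, Matrix.toLpLin_eq_toLin, LinearMap.det_toLin, expDiag, Matrix.det_diagonal,
    prod_exp_eq_one ht]

theorem abs_coordProd_le_norm_pow (x : EuclideanSpace ℝ (Fin d)) : |coordProd x| ≤ ‖x‖ ^ d := by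
  rw [coordProd, Finset.abs_prod]
  calc ∏ i, |x i| ≤ ∏ _i : Fin d, ‖x‖ :=
        Finset.prod_le_prod (fun _ _ => abs_nonneg _) fun i _ => PiLp.norm_apply_le x i
    _ = ‖x‖ ^ d := by simp

variable (L : Submodule ℤ (EuclideanSpace ℝ (Fin d)))

/-- Minkowski's theorem is applied to `L` and the preimage of a ball, not to the image lattice and
the ball: the fundamental domain stays fixed and the preimage has the ball's volume, so one radius
serves all `t`. -/
theorem exists_radius_forall_exists_norm_lt [NeZero d] [DiscreteTopology L] [IsZLattice ℝ L] :
    ∃ R : ℝ, ∀ t : Fin d → ℤ, ∑ i, t i = 0 →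
      ∃ l ∈ matrixImage (expDiag t) L, l ≠ 0 ∧ ‖l‖ < R := by
  set b := Module.Free.chooseBasis ℤ L
  have fund := ZLattice.isAddFundamentalDomain b (volume : Measure (EuclideanSpace ℝ (Fin d)))
  set D := ZSpan.fundamentalDomain (b.ofZLatticeBasis ℝ)
  have hD : volume D < ⊤ := (ZSpan.fundamentalDomain_isBounded _).measure_lt_top
  obtain ⟨n, hn⟩ : ∃ n : ℕ, volume D * 2 ^ d
      < volume (Metric.ball (0 : EuclideanSpace ℝ (Fin d)) n) := by
    have h1 := tendsto_measure_iUnion_atTop (μ := (volume : Measure (EuclideanSpace ℝ (Fin d))))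
      (s := fun n : ℕ => Metric.ball 0 (n : ℝ))
      fun m n hmn => Metric.ball_subset_ball (by exact_mod_cast hmn)
    rw [Metric.iUnion_ball_nat, measure_univ_of_isAddLeftInvariant] at h1
    exact (h1.eventually (lt_mem_nhds (ENNReal.mul_lt_top hD (by finiteness)))).exists
  refine ⟨n, fun t ht => ?_⟩
  set A := Matrix.toEuclideanLin (expDiag t) with hA
  have hdet : LinearMap.det A = 1 := det_toEuclideanLin_expDiag ht
  have hinj : Function.Injective A :=
    (LinearMap.equivOfDetNeZero A (by rw [hdet]; exact one_ne_zero)).injective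
  have hvol : volume (A ⁻¹' Metric.ball 0 n)
      = volume (Metric.ball (0 : EuclideanSpace ℝ (Fin d)) n) := by
    rw [Measure.addHaar_preimage_linearMap _ (by rw [hdet]; exact one_ne_zero), hdet]
    simp
  have : Countable L.toAddSubgroup := inferInstanceAs (Countable L)
  obtain ⟨x, hx0, hx⟩ := exists_ne_zero_mem_lattice_of_measure_mul_two_pow_lt_measure
    (L := L.toAddSubgroup) (s := A ⁻¹' Metric.ball 0 n) fund
    (fun x hx => by simpa using hx)
    ((convex_ball _ _).linear_preimage A) (by rwa [hvol, finrank_euclideanSpace_fin])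
  refine ⟨A x, Submodule.mem_map_of_mem (f := A.restrictScalars ℤ) x.2, ?_, by simpa using hx⟩
  rw [Ne, map_eq_zero_iff A hinj]
  simpa using hx0

theorem exists_shortestLength_bounds [NeZero d] [DiscreteTopology L] [IsZLattice ℝ L]
    (hL : IsAdmissible L) :
    ∃ a R : ℝ, 0 < a ∧ ∀ t : Fin d → ℤ, ∑ i, t i = 0 →
      a ≤ shortestLength (matrixImage (expDiag t) L) ∧
        shortestLength (matrixImage (expDiag t) L) ≤ R := by
  obtain ⟨C, hC, hadm⟩ := hL
  obtain ⟨R, hR⟩ := exists_radius_forall_exists_norm_lt L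
  refine ⟨C ^ (d : ℝ)⁻¹, R, Real.rpow_pos_of_pos hC _, fun t ht => ?_⟩
  obtain ⟨l, hl, hl0, hlR⟩ := hR t ht
  constructor
  · refine le_csInf ⟨_, l, hl, hl0, rfl⟩ ?_
    rintro _ ⟨m, hm, hm0, rfl⟩
    obtain ⟨y, hy, rfl⟩ := hm
    have hy0 : y ≠ 0 := by
      rintro rfl
      exact hm0 (map_zero _)
    refine le_of_pow_le_pow_left₀ (NeZero.ne d) (norm_nonneg _) ?_
    rw [Real.rpow_inv_natCast_pow hC.le (NeZero.ne d)]
    have h := hadm y hy hy0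
    rw [← coordProd_toEuclideanLin_expDiag ht y] at h
    exact h.trans (abs_coordProd_le_norm_pow _)
  · have hbdd : BddBelow {x : ℝ | ∃ l ∈ matrixImage (expDiag t) L, l ≠ 0 ∧ x = ‖l‖} := by
      refine ⟨0, ?_⟩
      rintro _ ⟨m, -, -, rfl⟩
      exact norm_nonneg m
    exact (csInf_le hbdd ⟨l, hl, hl0, rfl⟩).trans hlR.le

end ShortestLength

/-! ### Growth of the number of elements of `Δ_r`. -/

section Counting

variable {n : ℕ}

/-- Prepend to an integer vector the coordinate that makes the sum of all coordinates zero. -/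
def consNegSum (s : Fin n → ℤ) : Fin (n + 1) → ℤ := Fin.cons (-∑ i, s i) s

theorem sum_consNegSum (s : Fin n → ℤ) : ∑ i, consNegSum s i = 0 := by
  simp [consNegSum, Fin.sum_univ_succ]

theorem consNegSum_tail {t : Fin (n + 1) → ℤ} (ht : ∑ i, t i = 0) :
    consNegSum (Fin.tail t) = t := by
  rw [Fin.sum_univ_succ] at ht
  conv_rhs => rw [← Fin.cons_self_tail t]
  rw [consNegSum]
  congr 1
  exact (eq_neg_of_add_eq_zero_left ht).symm

/-- The element of `Δ` whose last `n` exponents are given by `s`. -/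
noncomputable def deltaOfTail (s : Fin n → ℤ) : Delta (n + 1) :=
  ⟨expDiag (consNegSum s), consNegSum s, sum_consNegSum s, rfl⟩

theorem expDiag_injective {d : ℕ} : Function.Injective (expDiag (d := d)) := by
  intro s t h
  funext i
  have := congrFun (Matrix.diagonal_injective h) i
  exact_mod_cast Real.exp_injective this

theorem deltaOfTail_injective : Function.Injective (deltaOfTail (n := n)) := by
  intro s t h
  have h' := expDiag_injective (Subtype.ext_iff.1 h)
  exact (Fin.cons_inj.1 h').2

theorem mem_deltaFinset {d : ℕ} {r : ℝ} {δ : Delta d} :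
    δ ∈ deltaFinset d r ↔ ∃ t : Fin d → ℤ, ∑ i, t i = 0 ∧ intVecNorm t ≤ r ∧ δ.1 = expDiag t := by
  simp [deltaFinset, DeltaBall]

theorem card_piFinset_Icc_neg (m : ℕ) :
    (Fintype.piFinset fun _ : Fin n => Finset.Icc (-(m : ℤ)) m).card = (2 * m + 1) ^ n := by
  rw [Fintype.card_piFinset_const, Int.card_Icc]
  congr 1
  lia

theorem intVecNorm_le_of_abs_le {d : ℕ} {t : Fin d → ℤ} {B : ℝ} (hB : 0 ≤ B)
    (h : ∀ i, |(t i : ℝ)| ≤ B) : intVecNorm t ≤ d * B := by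
  rw [intVecNorm, EuclideanSpace.norm_eq, Real.sqrt_le_left (by positivity)]
  calc ∑ i, ‖(t i : ℝ)‖ ^ 2 ≤ ∑ _i : Fin d, B ^ 2 := by
        gcongr with i
        exact h i
    _ = d * B ^ 2 := by simp
    _ ≤ (d * B) ^ 2 := by
        rw [mul_pow]
        gcongr
        exact_mod_cast Nat.le_self_pow two_ne_zero d

theorem le_card_deltaFinset {r : ℝ} (hr : 0 ≤ r) :
    (r / (n + 1) ^ 2) ^ n ≤ ((deltaFinset (n + 1) r).card : ℝ) := by
  -- If the tail is bounded by `m`, the prepended entry is at most `n * m`, so all `n + 1` entries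
  -- are at most `(n + 1) * m` and the norm at most `(n + 1) ^ 2 * m ≤ r`.
  set m := ⌊r / (n + 1) ^ 2⌋₊ with hm
  have hmr : (m : ℝ) ≤ r / (n + 1) ^ 2 := Nat.floor_le (by positivity)
  have hcard : (2 * m + 1) ^ n ≤ (deltaFinset (n + 1) r).card := by
    rw [← card_piFinset_Icc_neg]
    refine Finset.card_le_card_of_injOn deltaOfTail (fun s hs => ?_) deltaOfTail_injective.injOn
    have hs' : ∀ i, |s i| ≤ m := fun i => abs_le.2 (Finset.mem_Icc.1 (Fintype.mem_piFinset.1 hs i))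
    refine mem_deltaFinset.2 ⟨consNegSum s, sum_consNegSum s, ?_, rfl⟩
    have hb : ∀ i, |consNegSum s i| ≤ (n + 1) * m := by
      refine Fin.cases ?_ fun i => ?_
      · simp only [consNegSum, Fin.cons_zero, abs_neg]
        calc |∑ i, s i| ≤ ∑ i, |s i| := Finset.abs_sum_le_sum_abs _ _
          _ ≤ ∑ _i : Fin n, (m : ℤ) := Finset.sum_le_sum fun i _ => hs' i
          _ = n * m := by simp
          _ ≤ (n + 1) * m := by gcongr; lia
      · simp only [consNegSum, Fin.cons_succ]
        exact (hs' i).trans (le_mul_of_one_le_left (by positivity) (by lia))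
    have h := intVecNorm_le_of_abs_le (t := consNegSum s) (B := (n + 1) * m) (by positivity)
      fun i => by exact_mod_cast hb i
    refine h.trans ?_
    rw [le_div_iff₀ (by positivity)] at hmr
    push_cast
    linarith
  calc (r / (n + 1) ^ 2) ^ n ≤ (2 * m + 1 : ℝ) ^ n := by
        gcongr
        have := Nat.lt_floor_add_one (r / ((n : ℝ) + 1) ^ 2)
        rw [← hm] at this
        linarith [Nat.cast_nonneg (α := ℝ) m]
    _ ≤ _ := by exact_mod_cast hcard

theorem card_deltaFinset_le {r : ℝ} (hr : 1 ≤ r) :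
    ((deltaFinset (n + 1) r).card : ℝ) ≤ (3 * r) ^ n := by
  have hcard : (deltaFinset (n + 1) r).card ≤ (2 * ⌊r⌋₊ + 1) ^ n := by
    rw [← card_piFinset_Icc_neg]
    refine Finset.card_le_card_of_surjOn deltaOfTail fun δ hδ => ?_
    obtain ⟨t, ht, htr, hδt⟩ := mem_deltaFinset.1 hδ
    refine ⟨Fin.tail t, ?_, Subtype.ext ?_⟩
    · refine Fintype.mem_piFinset.2 fun i => Finset.mem_Icc.2 (abs_le.1 ?_)
      have h1 : |(t i.succ : ℝ)| ≤ r :=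
        (PiLp.norm_apply_le (WithLp.toLp 2 fun i => (t i : ℝ)) i.succ).trans htr
      have h2 : (t i.succ).natAbs ≤ ⌊r⌋₊ := Nat.le_floor (by rwa [Nat.cast_natAbs, Int.cast_abs])
      rw [Int.abs_eq_natAbs]
      exact_mod_cast h2
    · rw [hδt]
      exact congrArg expDiag (consNegSum_tail ht)
  calc ((deltaFinset (n + 1) r).card : ℝ) ≤ (2 * ⌊r⌋₊ + 1) ^ n := by exact_mod_cast hcard
    _ ≤ (3 * r) ^ n := by
        gcongr
        linarith [Nat.floor_le (zero_le_one.trans hr)]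

theorem card_deltaFinset_isTheta {d : ℕ} (hd : 1 ≤ d) :
    (fun r : ℝ => ((deltaFinset d r).card : ℝ)) =Θ[atTop] fun r => r ^ (d - 1) := by
  obtain ⟨n, rfl⟩ := Nat.exists_eq_add_of_le' hd
  constructor
  · refine IsBigO.of_bound (3 ^ n) ?_
    filter_upwards [eventually_ge_atTop 1] with r hr
    rw [Real.norm_of_nonneg (by positivity), Real.norm_of_nonneg (by positivity), Nat.add_sub_cancel,
      ← mul_pow]
    exact card_deltaFinset_le hr
  · refine IsBigO.of_bound (((n + 1 : ℝ) ^ 2) ^ n) ?_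
    filter_upwards [eventually_ge_atTop 0] with r hr
    rw [Real.norm_of_nonneg (by positivity), Real.norm_of_nonneg (by positivity)]
    have h := le_card_deltaFinset (n := n) hr
    rwa [div_pow, div_le_iff₀' (by positivity)] at h

end Counting

/-! ### Growth of the variance and the limit law. -/

theorem exists_weight_bounds {d : ℕ} [NeZero d] (L : Submodule ℤ (EuclideanSpace ℝ (Fin d)))
    [DiscreteTopology L] [IsZLattice ℝ L] (hL : IsAdmissible L) :
    ∃ a b : ℝ, 0 < a ∧ ∀ δ : Delta d,
      a ≤ 1 / shortestLength (matrixImage δ.1 L) ^ d ∧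
        1 / shortestLength (matrixImage δ.1 L) ^ d ≤ b := by
  obtain ⟨a, R, ha, h⟩ := exists_shortestLength_bounds L hL
  have hR : 0 < R := ha.trans_le ((h 0 (by simp)).1.trans (h 0 (by simp)).2)
  refine ⟨1 / R ^ d, 1 / a ^ d, by positivity, ?_⟩
  rintro ⟨_, t, ht, rfl⟩
  obtain ⟨h1, h2⟩ := h t ht
  have h0 := ha.trans_le h1
  constructor <;> gcongr

theorem tildeV_eq_sum_sq {d : ℕ} (L : Submodule ℤ (EuclideanSpace ℝ (Fin d))) (r : ℝ) :
    tildeV L r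
      = ∑ δ ∈ deltaFinset d r, (1 / shortestLength (matrixImage δ.1 L) ^ d) ^ 2 := by
  simp only [tildeV, div_pow, one_pow, ← pow_mul, mul_comm 2 d]

theorem tildeV_isTheta {d : ℕ} [NeZero d] (L : Submodule ℤ (EuclideanSpace ℝ (Fin d)))
    [DiscreteTopology L] [IsZLattice ℝ L] (hL : IsAdmissible L) :
    tildeV L =Θ[atTop] fun r : ℝ => r ^ (d - 1) := by
  obtain ⟨a, b, ha, hab⟩ := exists_weight_bounds L hL
  refine IsTheta.trans ?_ (card_deltaFinset_isTheta (NeZero.one_le (n := d)))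
  have hV0 r : 0 ≤ tildeV L r := by
    rw [tildeV_eq_sum_sq]
    positivity
  constructor
  · refine IsBigO.of_bound (b ^ 2) (Eventually.of_forall fun r => ?_)
    rw [Real.norm_of_nonneg (hV0 r), Real.norm_of_nonneg (by positivity), tildeV_eq_sum_sq,
      mul_comm, ← nsmul_eq_mul]
    refine Finset.sum_le_card_nsmul _ _ _ fun δ _ => ?_
    exact pow_le_pow_left₀ (ha.le.trans (hab δ).1) (hab δ).2 2
  · refine IsBigO.of_bound ((a ^ 2)⁻¹) (Eventually.of_forall fun r => ?_)
    rw [Real.norm_of_nonneg (hV0 r), Real.norm_of_nonneg (by positivity), tildeV_eq_sum_sq,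
      le_inv_mul_iff₀' (by positivity), ← nsmul_eq_mul]
    refine Finset.card_nsmul_le_sum _ _ _ fun δ _ => ?_
    exact pow_le_pow_left₀ ha.le (hab δ).1 2

theorem integral_eq_zero_of_identDistrib_neg {Ω : Type*} [MeasurableSpace Ω] {P : Measure Ω}
    {X : Ω → ℝ} (h : IdentDistrib X (fun ω => -X ω) P P) : ∫ ω, X ω ∂P = 0 := by
  have := h.integral_eq
  rw [integral_neg] at this
  linarith

theorem theorem14 {d : ℕ} (hd : 2 ≤ d)
    (L : Submodule ℤ (EuclideanSpace ℝ (Fin d))) [DiscreteTopology L] [IsZLattice ℝ L]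
    (hunimodular : ZLattice.covolume L = 1) (hadm : IsAdmissible L)
    {Ω : Type*} [MeasurableSpace Ω] (P : Measure Ω) [IsProbabilityMeasure P]
    (θ : Delta d → Ω → ℝ)
    (hindep : iIndepFun θ P)
    (hident : ∀ δ δ' : Delta d, IdentDistrib (θ δ) (θ δ') P P)
    (hsymm : ∀ δ : Delta d, IdentDistrib (θ δ) (fun ω => -θ δ ω) P P)
    (hmoment : ∀ δ : Delta d, MemLp (θ δ) 3 P)
    (v : ℝ≥0) (hv : ∀ δ : Delta d, ∫ ω, θ δ ω ^ 2 ∂P = v) :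
    (tildeV L =Θ[atTop] fun r : ℝ => r ^ (d - 1)) ∧
      TendstoInDistribution (fun (r : ℝ) (ω : Ω) => tildeS θ L ω r / √(tildeV L r)) atTop
        (id : ℝ → ℝ) (fun _ => P) (gaussianReal 0 v) := by
  have : NeZero d := ⟨by lia⟩
  have hV := tildeV_isTheta L hadm
  refine ⟨hV, ?_⟩
  have hVtop : Tendsto (tildeV L) atTop atTop := by
    -- Here `d ≥ 2` enters: the exponent `d - 1` must be nonzero.
    have h := hV.tendsto_norm_atTop_iff.2
      (tendsto_norm_atTop_atTop.comp (tendsto_pow_atTop (α := ℝ) (n := d - 1) (by lia)))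
    refine h.congr fun r => Real.norm_of_nonneg ?_
    rw [tildeV_eq_sum_sq]
    positivity
  obtain ⟨a, b, ha, hab⟩ := exists_weight_bounds L hadm
  -- The identity matrix serves as reference index for the common law.
  let δ₀ : Delta d := ⟨expDiag 0, 0, by simp, rfl⟩
  have key := tendstoInDistribution_weighted_sum ((hmoment δ₀).mono_exponent (by norm_num))
    (integral_eq_zero_of_identDistrib_neg (hsymm δ₀)) (hv δ₀) hindep (fun δ => hident δ δ₀)
    (w := fun δ => 1 / shortestLength (matrixImage δ.1 L) ^ d) (c := b)
    (fun δ => by rw [abs_of_nonneg (ha.le.trans (hab δ).1)]; exact (hab δ).2)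
    (F := deltaFinset d) (l := atTop) (hVtop.congr fun r => tildeV_eq_sum_sq L r)
  simpa only [tildeS, ← tildeV_eq_sum_sq, mul_one_div] using key
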